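/- For $\gamma\in[0.9,1)$ let $\Gamma=(1-\gamma)^{-1}$. For $p\in(0,1)$ let $M_{\gamma,p}$ be the discounted Markov decision process with discount factor $\gamma$, two states $s,t$ and a single action, in which: from $s$ the reward is $1$ and the next state is $s$ with probability $p$ and $t$ with probability $1-p$; from $t$ the reward is $0$ and the next state is $t$. Write $p(\cdot\mid x)$ for the distribution of the next state from state $x$ (the action is omitted, as there is only one), and $v^*$, $q^*$ for the optimal value function and the optimal Q-function. For every $\delta\in(0,1/2)$ there is a constant $c>0$, depending only on $\delta$, such that the following holds for every $\gamma\in[0.9,1)$ and every $\varepsilon\in(0,\Gamma/4)$. Suppose that an algorithm, which knows $\gamma$, $\varepsilon$, $\delta$ and the rewards but not $p$, outputs with probability at least $1-\delta$ an approximation $\hat v$ with $\|\hat v-v^*\|_\infty\le\varepsilon$ (or, alternatively, $\hat q$ with $\|\hat q-q^*\|_\infty\le\varepsilon$) for every $M_{\gamma,p}$ with $p\in(0,1)$ satisfying the promise that $p\le 1-\frac1\Gamma$ or $p\ge 1-\frac1\Gamma+\frac{3\varepsilon}{\Gamma^2}$. 1. If the algorithm is a randomized adaptive algorithm with access to a classical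 generative oracle, which answers each query $x$ with a fresh sample from $p(\cdot\mid x)$, then it makes at least $c\,\Gamma^3/\varepsilon^2$ queries in the worst case. 2. If the algorithm is a quantum algorithm with access to a quantum generative oracle, then it makes at least $c\,\Gamma^{1.5}/\varepsilon$ queries. Here a quantum generative oracle with ancilla dimension $J\ge1$ is any unitary $\mathcal O$ with $\mathcal O\,|x\rangle|0\rangle|0\rangle=|x\rangle\sum_{x'}\sqrt{p(x'\mid x)}\,|x'\rangle|\psi_{x',x}\rangle$ for all states $x$, where $|\psi_{x',x}\rangle\in\mathbb C^J$ are arbitrary unit vectors; the algorithm has to succeed for every such oracle of the given dimension $J$, and each of its queries may apply $\mathcal O$ or $\mathcal O^{-1}$, possibly controlled. The constant $c$ does not depend on $J$. -/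

import Mathlib

open MeasureTheory ProbabilityTheory

noncomputable section

/-! ### Infinite-horizon discounted Markov decision processes -/

/-- A finite discounted MDP `(S, A, p, r, γ)`; `p s a s'` is the probability `p(s'|s,a)`. -/
structure MDP (S A : Type) [Fintype S] where
  p : S → A → S → ℝ
  p_nonneg : ∀ s a s', 0 ≤ p s a s'
  p_sum : ∀ s a, ∑ s', p s a s' = 1
  r : S → A → ℝ
  r_mem : ∀ s a, r s a ∈ Set.Icc (0 : ℝ) 1
  discount : ℝ
  discount_mem : discount ∈ Set.Ico (0 : ℝ) 1

namespace MDP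

variable {S A : Type} [Fintype S]

/-- The distribution `p(·|s,a)` of the next state. -/
def next (M : MDP S A) (s : S) (a : A) : PMF S :=
  PMF.ofFintype (fun s' => ENNReal.ofReal (M.p s a s')) (by
    rw [← ENNReal.ofReal_sum_of_nonneg (fun s' _ => M.p_nonneg s a s'), M.p_sum,
      ENNReal.ofReal_one])

variable [MeasurableSpace S] [DiscreteMeasurableSpace S]

/-- Transition kernel from the states up to time `n` to the state at time `n + 1`, when the action
taken in state `s` at time `n` is `act n s`. -/
def stepKernel (M : MDP S A) (act : ℕ → S → A) (n : ℕ) :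
    Kernel ((i : Finset.Iic n) → (fun _ : ℕ => S) i) S where
  toFun x := (M.next (x ⟨n, Finset.mem_Iic.2 le_rfl⟩)
    (act n (x ⟨n, Finset.mem_Iic.2 le_rfl⟩))).toMeasure
  measurable' :=
    (Measurable.of_discrete (f := fun s : S => (M.next s (act n s)).toMeasure)).comp
      (measurable_pi_apply (⟨n, Finset.mem_Iic.2 le_rfl⟩ : Finset.Iic n))

instance (M : MDP S A) (act : ℕ → S → A) (n : ℕ) : IsMarkovKernel (M.stepKernel act n) :=
  ⟨fun x => by
    change IsProbabilityMeasure (PMF.toMeasure _)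
    infer_instance⟩

/-- Law of the state trajectory `(s₀, s₁, s₂, …)` with `s₀ = s`, `aₙ = act n sₙ` and
`sₙ₊₁ ∼ p(·|sₙ,aₙ)`. -/
def trajectoryLaw (M : MDP S A) (act : ℕ → S → A) (s : S) : Measure (ℕ → S) :=
  Kernel.traj (X := fun _ => S) (M.stepKernel act) 0 (fun _ => s)

/-- The expected discounted return `𝔼[∑ₜ γᵗ r[sₜ, aₜ] | s₀ = s, aₙ = act n sₙ]`. -/
def expectedReturn (M : MDP S A) (act : ℕ → S → A) (s : S) : ℝ :=
  ∫ x, ∑' t : ℕ, M.discount ^ t * M.r (x t) (act t (x t)) ∂(M.trajectoryLaw act s)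

/-- The value `v^π[s]` of a policy `π`. -/
def policyValue (M : MDP S A) (π : S → A) (s : S) : ℝ :=
  M.expectedReturn (fun _ => π) s

/-- The Q-function `q^π[s,a]` of a policy `π`: the first action is `a`, afterwards `π` is used. -/
def policyQ (M : MDP S A) (π : S → A) (s : S) (a : A) : ℝ :=
  M.expectedReturn (fun n s' => if n = 0 then a else π s') s

/-- The optimal value function `v*`. -/
def vStar (M : MDP S A) : S → ℝ := fun s => ⨆ π : S → A, M.policyValue π s

/-- The optimal Q-function `q*`. -/
def qStar (M : MDP S A) : S × A → ℝ := fun x => ⨆ π : S → A, M.policyQ π x.1 x.2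

end MDP

/-! ### Algorithms with a classical generative oracle -/

/-- A randomized adaptive algorithm for MDPs with known states, actions, rewards and discount, which
makes `numQueries` queries to a generative oracle. It draws a seed; with seed `ω`, after the answers
`h`, its next query is the state-action pair `query ω h`, and after all queries its output is
`output ω h`. (An algorithm that may stop earlier makes and ignores further queries.) -/
structure ClassicalAlgorithm (S A Out : Type) [MeasurableSpace Out] where
  numQueries : ℕ
  Seed : Type
  [seedSpace : MeasurableSpace Seed]
  seedLaw : Measure Seed
  [isProb : IsProbabilityMeasure seedLaw]
  query : Seed → List S → S × A
  measurableSet_query : ∀ h x, MeasurableSet {ω | query ω h = x}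
  output : Seed → List S → Out
  measurable_output : ∀ h, Measurable fun ω => output ω h

attribute [instance] ClassicalAlgorithm.seedSpace ClassicalAlgorithm.isProb

namespace ClassicalAlgorithm

variable {S A Out : Type} [Fintype S] [MeasurableSpace Out]

/-- Probability that the output lies in `good`, given the seed `ω` and the answers `h` so far, when
`n` further queries are made to the classical generative oracle of `M`, which answers a query
`(s, a)` by a fresh sample from `p(·|s,a)`. -/
def successFrom (alg : ClassicalAlgorithm S A Out) (M : MDP S A) (good : Set Out)
    (ω : alg.Seed) : ℕ → List S → ℝ
  | 0, h => good.indicator 1 (alg.output ω h)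
  | n + 1, h => ∑ s', M.p (alg.query ω h).1 (alg.query ω h).2 s' *
      successFrom alg M good ω n (h ++ [s'])

/-- Probability that the output lies in `good`, given the classical generative oracle of `M`. -/
def successProb (alg : ClassicalAlgorithm S A Out) (M : MDP S A) (good : Set Out) : ℝ :=
  ∫ ω, alg.successFrom M good ω alg.numQueries [] ∂alg.seedLaw

end ClassicalAlgorithm

/-- For every `M ∈ 𝓜`, given the classical generative oracle of `M`, the algorithm outputs with
probability at least `1 - δ` an approximation to `target M` up to error `ε`. -/
def ClassicalAlgorithm.Approximates {S A Out : Type} [Fintype S] [NormedAddCommGroup Out]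
    [MeasurableSpace Out] (alg : ClassicalAlgorithm S A Out) (𝓜 : Set (MDP S A))
    (target : MDP S A → Out) (ε δ : ℝ) : Prop :=
  ∀ M ∈ 𝓜, 1 - δ ≤ alg.successProb M {o | ‖target M - o‖ ≤ ε}

/-! ### Algorithms with a quantum generative oracle -/

/-- Basis of `ℂ^S ⊗ ℂ^A ⊗ ℂ^S ⊗ ℂ^J`, the space on which a quantum generative oracle acts. -/
abbrev QReg (S A J : Type) : Type := S × A × S × J

/-- The unitary `O` is a quantum generative model of `M`: for unit vectors `|ψ_{s',s,a}⟩ ∈ ℂ^J`,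
`O |s⟩|a⟩|0⟩|0⟩ = |s⟩|a⟩ ∑_{s'} √p(s'|s,a) |s'⟩|ψ_{s',s,a}⟩`. The basis vectors `|0⟩` of `ℂ^S` and
`ℂ^J` are those of the default elements. -/
def IsQuantumGenerativeOracle {S A J : Type} [Fintype S] [DecidableEq S] [Inhabited S]
    [Fintype A] [DecidableEq A] [Fintype J] [DecidableEq J] [Inhabited J]
    (M : MDP S A) (O : Matrix.unitaryGroup (QReg S A J) ℂ) : Prop :=
  ∃ ψ : S → S → A → EuclideanSpace ℂ J, (∀ s' s a, ‖ψ s' s a‖ = 1) ∧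
    ∀ s a, Matrix.mulVec (O : Matrix (QReg S A J) (QReg S A J) ℂ)
        (Pi.single (s, a, default, default) 1) =
      fun x => if x.1 = s ∧ x.2.1 = a then
        (Real.sqrt (M.p s a x.2.2.1) : ℂ) * ψ x.2.2.1 s a x.2.2.2 else 0

/-- What a query does to the query register: nothing, the oracle, or its inverse. -/
inductive QueryMode
  | skip
  | forward
  | inverse

/-- A quantum algorithm that makes `numQueries` queries to a unitary on the query register `Q`. It
has a workspace `W`, starts in a basis state, alternates fixed unitaries with queries, measures in
the computational basis at the end, and outputs a function of the outcome. A query applies the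
oracle, its inverse or the identity to `Q`, controlled by the basis state of `W`; this covers plain,
inverse and controlled queries. -/
structure QuantumAlgorithm (Q Out : Type) [Fintype Q] [DecidableEq Q] where
  numQueries : ℕ
  W : Type
  [fintypeW : Fintype W]
  [decEqW : DecidableEq W]
  start : Q × W
  gate : ℕ → Matrix.unitaryGroup (Q × W) ℂ
  mode : ℕ → W → QueryMode
  output : Q × W → Out

attribute [instance] QuantumAlgorithm.fintypeW QuantumAlgorithm.decEqW

namespace QuantumAlgorithm

variable {Q Out : Type} [Fintype Q] [DecidableEq Q]

/-- The operator that a query in the given mode applies to the query register. -/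
def modeOp (O : Matrix.unitaryGroup Q ℂ) : QueryMode → Matrix Q Q ℂ
  | .skip => 1
  | .forward => O
  | .inverse => Matrix.conjTranspose (O : Matrix Q Q ℂ)

/-- The operator `∑_w modeOp O (mode t w) ⊗ |w⟩⟨w|` of query number `t`. -/
def queryOp (alg : QuantumAlgorithm Q Out) (O : Matrix.unitaryGroup Q ℂ) (t : ℕ) :
    Matrix (Q × alg.W) (Q × alg.W) ℂ :=
  Matrix.blockDiagonal fun w => modeOp O (alg.mode t w)

/-- The state vector after `t` queries. -/
def state (alg : QuantumAlgorithm Q Out) (O : Matrix.unitaryGroup Q ℂ) : ℕ → (Q × alg.W → ℂ)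
  | 0 => Matrix.mulVec (alg.gate 0 : Matrix (Q × alg.W) (Q × alg.W) ℂ) (Pi.single alg.start 1)
  | t + 1 => Matrix.mulVec (alg.gate (t + 1) : Matrix (Q × alg.W) (Q × alg.W) ℂ)
      (Matrix.mulVec (alg.queryOp O t) (state alg O t))

/-- Probability that the output lies in `good`, given the oracle `O`. -/
def successProb (alg : QuantumAlgorithm Q Out) (O : Matrix.unitaryGroup Q ℂ) (good : Set Out) : ℝ :=
  ∑ x, ‖alg.state O alg.numQueries x‖ ^ 2 * good.indicator 1 (alg.output x)

end QuantumAlgorithm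

/-- For every `M ∈ 𝓜`, given any quantum generative oracle of `M`, the algorithm outputs with
probability at least `1 - δ` an approximation to `target M` up to error `ε`. -/
def QuantumAlgorithm.Approximates {S A J Out : Type} [Fintype S] [DecidableEq S] [Inhabited S]
    [Fintype A] [DecidableEq A] [Fintype J] [DecidableEq J] [Inhabited J] [NormedAddCommGroup Out]
    (alg : QuantumAlgorithm (QReg S A J) Out) (𝓜 : Set (MDP S A))
    (target : MDP S A → Out) (ε δ : ℝ) : Prop :=
  ∀ M ∈ 𝓜, ∀ O : Matrix.unitaryGroup (QReg S A J) ℂ, IsQuantumGenerativeOracle M O →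
    1 - δ ≤ alg.successProb O {o | ‖target M - o‖ ≤ ε}

/-! ### The two-state, one-action MDP -/

/-- The effective horizon `Γ = (1 - γ)⁻¹`. -/
def horizon (γ : ℝ) : ℝ := (1 - γ)⁻¹

/-- Two states `0` (the source `s`) and `1` (the sink `t`) and one action. From `0` the reward is `1`
and the next state is `0` with probability `p` and `1` with probability `1 - p`. From `1` the reward
is `0` and the next state is `1`. -/
def twoStateMDP (γ : Set.Ico (0 : ℝ) 1) (p : Set.Ioo (0 : ℝ) 1) : MDP (Fin 2) (Fin 1) where
  p s _ s' := if s = 0 then (if s' = 0 then (p : ℝ) else 1 - p) else (if s' = 0 then 0 else 1)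
  p_nonneg := by
    intro s _ s'
    have h0 := p.2.1
    have h1 := p.2.2
    split_ifs <;> linarith
  p_sum := by
    intro s _
    by_cases h : s = 0 <;> simp [h]
  r s _ := if s = 0 then 1 else 0
  r_mem := by
    intro s _
    split_ifs <;> simp
  discount := γ
  discount_mem := γ.2

/-- The two-state MDPs with discount `γ` whose unknown `p ∈ (0,1)` satisfies the promise
`p ≤ 1 - 1/Γ` or `p ≥ 1 - 1/Γ + 3ε/Γ²`. -/
def promisedFamily (γ : Set.Ico (0 : ℝ) 1) (ε : ℝ) : Set (MDP (Fin 2) (Fin 1)) :=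
  {M | ∃ p : Set.Ioo (0 : ℝ) 1, ((p : ℝ) ≤ 1 - 1 / horizon γ ∨
      1 - 1 / horizon γ + 3 * ε / horizon γ ^ 2 ≤ (p : ℝ)) ∧ M = twoStateMDP γ p}

end

/-! ### The optimal value of the two-state MDP -/

namespace MDP

variable {S A : Type} [Fintype S] [MeasurableSpace S] [DiscreteMeasurableSpace S]

/-! The source has value 1/(1 - γp), since the reward at time t is collected with probability p^t.
Put u = 1/Γ and e = ε/Γ < 1/4. The values p = 1 - u(1 + 20e) and p = 1 - u(1 - 3e) both satisfy the
promise, and their source values differ by more than 2ε (`exists_separated_pair`). Hence no output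
is ε-correct for both, and a successful algorithm has to tell the two instances apart with bias 1 -
2δ.

Each query reveals little. The parameters differ by 23ue, while 1 - p has order u, so the squared
Hellinger distance D = (√a - √b)² + (√(1-a) - √(1-b))² of the two next-state laws is at most
2(23ue)²/u = 1058 ε²/Γ³.

Classically, the affinity (Bhattacharyya coefficient) is at least 1 - D/2 per query and multiplies
along adaptive queries (`ClassicalAlgorithm.pow_le_affinity`). For n queries this gives (1 - 2δ)² ≤
nD, hence Γ³/ε².

In the quantum case the oracles may be chosen as rotations, whose difference has operator norm
exactly √D. By the hybrid argument (`QuantumAlgorithm.norm_state_sub_le`) the final states are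
within n√D, so 1 - 2δ ≤ 2n√D. The square root turns Γ³/ε² into Γ^1.5/ε. The rotations ignore the
ancilla, so nothing depends on J. -/

instance (M : MDP S A) (act : ℕ → S → A) (s : S) :
    IsProbabilityMeasure (M.trajectoryLaw act s) := by
  unfold trajectoryLaw
  infer_instance

theorem integrable_trajectoryLaw (M : MDP S A) (act : ℕ → S → A) (s : S) (f : S → ℝ) (n : ℕ) :
    Integrable (fun x => f (x n)) (M.trajectoryLaw act s) :=
  Integrable.of_bound
    ((Measurable.of_discrete (f := f)).comp (measurable_pi_apply n)).aestronglyMeasurable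
    (∑ s, ‖f s‖)
    (Filter.Eventually.of_forall fun x =>
      Finset.single_le_sum (f := fun s => ‖f s‖) (fun _ _ => norm_nonneg _)
        (Finset.mem_univ (x n)))

theorem integral_trajectoryLaw_zero (M : MDP S A) (act : ℕ → S → A) (s : S) (f : S → ℝ) :
    ∫ x, f (x 0) ∂M.trajectoryLaw act s = f s := by
  unfold trajectoryLaw
  rw [Kernel.integral_traj]
  · simp [Function.updateFinset]
  · exact (Measurable.of_discrete (f := f)).comp (measurable_pi_apply 0) |>.aestronglyMeasurable

/-- The tower property: condition on the states up to time n, after which the next state has law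
given by `stepKernel`. -/
theorem integral_trajectoryLaw_succ (M : MDP S A) (act : ℕ → S → A) (s : S) (f : S → ℝ) (n : ℕ) :
    ∫ x, f (x (n + 1)) ∂M.trajectoryLaw act s =
      ∫ x, ∑ s', M.p (x n) (act n (x n)) s' * f s' ∂M.trajectoryLaw act s := by
  have hstep : ∀ y : (i : Finset.Iic n) → S,
      ∫ x, f (x (n + 1)) ∂Kernel.traj (X := fun _ => S) (M.stepKernel act) n y =
        ∑ s', M.p (y ⟨n, Finset.mem_Iic.2 le_rfl⟩)
          (act n (y ⟨n, Finset.mem_Iic.2 le_rfl⟩)) s' * f s' := by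
    intro y
    have h := congrArg (fun κ => κ y)
      (Kernel.map_traj_succ_self (X := fun _ => S) (κ := M.stepKernel act) (a := n))
    rw [Kernel.map_apply _ (measurable_pi_apply _)] at h
    rw [← integral_map (φ := fun x : ℕ → S => x (n + 1)) (measurable_pi_apply _).aemeasurable
      (Measurable.of_discrete (f := f)).aestronglyMeasurable, h]
    change ∫ s', f s' ∂(M.next _ _).toMeasure = _
    rw [PMF.integral_eq_sum]
    refine Finset.sum_congr rfl fun s' _ => ?_
    simp [next, ENNReal.toReal_ofReal (M.p_nonneg _ _ _)]
  have h := M.integrable_trajectoryLaw act s f (n + 1)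
  unfold trajectoryLaw at h ⊢
  rw [← Kernel.integral_traj_partialTraj (Nat.zero_le n) h]
  simp_rw [hstep]
  -- The law of the first n + 1 states is the image of the trajectory law under restriction, so the
  -- integral over prefixes becomes one over trajectories.
  rw [← Kernel.traj_map_frestrictLe_apply, integral_map]
  · rfl
  · exact (Preorder.measurable_frestrictLe n).aemeasurable
  · exact Measurable.aestronglyMeasurable ((Measurable.of_discrete
      (f := fun z : S => ∑ s', M.p z (act n z) s' * f s')).comp (measurable_pi_apply _))

/-- Rewards lie in [0,1], so the geometric series dominates and justifies exchanging sum and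
integral. -/
theorem expectedReturn_eq_tsum (M : MDP S A) (π : S → A) (s : S) :
    M.expectedReturn (fun _ => π) s =
      ∑' t : ℕ, M.discount ^ t * ∫ x, M.r (x t) (π (x t)) ∂M.trajectoryLaw (fun _ => π) s := by
  have hint := fun t => (M.integrable_trajectoryLaw (fun _ => π) s
    (fun z => M.r z (π z)) t).const_mul (M.discount ^ t)
  unfold expectedReturn
  rw [← integral_tsum_of_summable_integral_norm hint]
  · simp_rw [integral_const_mul]
  · refine Summable.of_nonneg_of_le (fun t => integral_nonneg fun _ => norm_nonneg _) (fun t => ?_)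
      (summable_geometric_of_lt_one M.discount_mem.1 M.discount_mem.2)
    calc _ ≤ ∫ x, M.discount ^ t ∂M.trajectoryLaw (fun _ => π) s := by
          refine integral_mono (hint t).norm (integrable_const _) fun x => ?_
          have h := M.r_mem (x t) (π (x t))
          have hg := pow_nonneg M.discount_mem.1 t
          simp only [norm_mul, Real.norm_of_nonneg hg, Real.norm_of_nonneg h.1]
          exact mul_le_of_le_one_right hg h.2
      _ = _ := by simp

end MDP

theorem twoStateMDP_expectedReturn (γ : Set.Ico (0 : ℝ) 1) (p : Set.Ioo (0 : ℝ) 1)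
    (act : ℕ → Fin 2 → Fin 1) :
    (twoStateMDP γ p).expectedReturn act 0 = (1 - γ * p : ℝ)⁻¹ := by
  obtain rfl : act = fun _ _ => 0 := Subsingleton.elim _ _
  -- The reward is the indicator of the source, which is still occupied at time t with probability
  -- p^t.
  have hprob : ∀ t, ∫ x, (twoStateMDP γ p).r (x t) 0
      ∂(twoStateMDP γ p).trajectoryLaw (fun _ _ => 0) 0 = (p : ℝ) ^ t := by
    intro t
    induction t with
    | zero =>
      rw [MDP.integral_trajectoryLaw_zero _ _ _ fun s => (twoStateMDP γ p).r s 0]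
      simp [twoStateMDP]
    | succ t ih =>
      rw [MDP.integral_trajectoryLaw_succ _ _ _ fun s => (twoStateMDP γ p).r s 0,
        pow_succ', ← ih, ← integral_const_mul]
      refine integral_congr_ae (Filter.Eventually.of_forall fun x => ?_)
      simp [twoStateMDP]
  rw [MDP.expectedReturn_eq_tsum]
  simp_rw [hprob]
  change ∑' t, (γ : ℝ) ^ t * (p : ℝ) ^ t = _
  simp_rw [← mul_pow]
  exact tsum_geometric_of_lt_one (mul_nonneg γ.2.1 p.2.1.le)
    (mul_lt_one_of_nonneg_of_lt_one_left γ.2.1 γ.2.2 p.2.2.le)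

theorem twoStateMDP_vStar (γ : Set.Ico (0 : ℝ) 1) (p : Set.Ioo (0 : ℝ) 1) :
    (twoStateMDP γ p).vStar 0 = (1 - γ * p : ℝ)⁻¹ := by
  simp [MDP.vStar, MDP.policyValue, twoStateMDP_expectedReturn]

theorem twoStateMDP_qStar (γ : Set.Ico (0 : ℝ) 1) (p : Set.Ioo (0 : ℝ) 1) :
    (twoStateMDP γ p).qStar (0, 0) = (1 - γ * p : ℝ)⁻¹ := by
  simp [MDP.qStar, MDP.policyQ, twoStateMDP_expectedReturn]

/-! ### A pair of MDPs that are hard to tell apart -/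

/-- Rationalise the difference of roots: (√x + √y)² ≥ x. -/
theorem sq_sqrt_sub_sqrt_le {x y : ℝ} (hx : 0 < x) (hy : 0 ≤ y) :
    (√x - √y) ^ 2 ≤ (x - y) ^ 2 / x := by
  rw [le_div_iff₀ hx]
  have h1 := Real.sq_sqrt hx.le
  have h2 := Real.sq_sqrt hy
  have hsub : x - y = (√x - √y) * (√x + √y) := by linear_combination -h1 + h2
  rw [hsub, mul_pow]
  refine mul_le_mul_of_nonneg_left ?_ (sq_nonneg _)
  nlinarith [Real.sqrt_nonneg x, Real.sqrt_nonneg y,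
    mul_nonneg (Real.sqrt_nonneg x) (Real.sqrt_nonneg y)]

/-- The two boundary points of the promise are too close: near γ = 1 and for small e their values
differ by only about 3ε/4. The smaller parameter is therefore moved below 1 - 1/Γ, far enough for
separation 2ε but still at distance O(ε/Γ²), which keeps the Hellinger distance of the required
order. -/
theorem exists_separated_pair (γ : Set.Ico (0 : ℝ) 1) (hγ : 0.9 ≤ (γ : ℝ)) (ε : ℝ)
    (hε : ε ∈ Set.Ioo (0 : ℝ) (horizon γ / 4)) :
    ∃ a b : Set.Ioo (0 : ℝ) 1,
      twoStateMDP γ a ∈ promisedFamily γ ε ∧ twoStateMDP γ b ∈ promisedFamily γ ε ∧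
      2 * ε < (1 - γ * b : ℝ)⁻¹ - (1 - γ * a : ℝ)⁻¹ ∧
      (√(a : ℝ) - √(b : ℝ)) ^ 2 + (√(1 - a : ℝ) - √(1 - b : ℝ)) ^ 2 ≤
        1058 * (ε ^ 2 / horizon γ ^ 3) := by
  obtain ⟨g, hg0, hg1⟩ := γ
  simp only at hγ
  obtain ⟨hε0, hε1⟩ := hε
  norm_num at hγ
  simp only [horizon] at hε1
  obtain ⟨u, rfl⟩ : ∃ u, g = 1 - u := ⟨1 - g, by ring⟩
  have hu0 : 0 < u := by linarith
  have hu1 : u ≤ 1 / 10 := by linarith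
  obtain ⟨e, rfl⟩ : ∃ e, ε = e / u := ⟨ε * u, by field_simp⟩
  have he0 : 0 < e := by
    rcases div_pos_iff.1 hε0 with h | h <;> linarith [h.1, h.2]
  have he1 : e < 1 / 4 := by
    rw [sub_sub_cancel, inv_eq_one_div, div_div, div_lt_div_iff₀ hu0 (by positivity)] at hε1
    nlinarith
  have hhor : horizon (1 - u) = u⁻¹ := by simp [horizon]
  have ha1 : 0 < u * (1 + 20 * e) := by positivity
  have ha2 : u * (1 + 20 * e) < 6 / 10 := by nlinarith
  have hb1 : 0 < u * (1 - 3 * e) := mul_pos hu0 (by linarith)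
  have hb2 : u * (1 - 3 * e) < 1 / 10 := by nlinarith [mul_pos hu0 he0]
  -- The second witness is the upper promise boundary itself, since 3ue = 3ε/Γ². The 20 in the first
  -- leaves room for the separation and keeps 1 - a below 6/10.
  refine ⟨⟨1 - u * (1 + 20 * e), by constructor <;> linarith⟩,
    ⟨1 - u * (1 - 3 * e), by constructor <;> linarith⟩,
    ⟨_, Or.inl ?_, rfl⟩, ⟨_, Or.inr ?_, rfl⟩, ?_, ?_⟩
  · simp only [hhor, one_div, inv_inv]
    nlinarith [mul_pos hu0 he0]
  · simp only [hhor, one_div, inv_inv]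
    refine le_of_eq ?_
    field_simp
    ring
  · simp only
    have hA : 1 - (1 - u) * (1 - u * (1 + 20 * e)) = u * (1 + (1 - u) * (1 + 20 * e)) := by ring
    have hB : 1 - (1 - u) * (1 - u * (1 - 3 * e)) = u * (1 + (1 - u) * (1 - 3 * e)) := by ring
    have hA0 : 0 < 1 + (1 - u) * (1 + 20 * e) := by nlinarith
    have hB0 : 0 < 1 + (1 - u) * (1 - 3 * e) := by nlinarith
    rw [hA, hB, inv_sub_inv (by positivity) (by positivity), lt_div_iff₀ (by positivity)]
    have hA2 : 1 + (1 - u) * (1 + 20 * e) ≤ 2 + 20 * e := by nlinarith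
    have hB2 : 1 + (1 - u) * (1 - 3 * e) ≤ 2 - 3 * e := by nlinarith
    have hAB : (1 + (1 - u) * (1 - 3 * e)) * (1 + (1 - u) * (1 + 20 * e)) ≤
        (2 - 3 * e) * (2 + 20 * e) := mul_le_mul hB2 hA2 hA0.le (by linarith)
    -- For e < 1/4 the bound `hAB` is below 8.75, and 2 · 8.75 = 17.5 is less than 23 · 0.9 = 20.7.
    have key : 2 * ((1 + (1 - u) * (1 - 3 * e)) * (1 + (1 - u) * (1 + 20 * e))) <
        23 * (1 - u) := by nlinarith
    calc 2 * (e / u) * (u * (1 + (1 - u) * (1 - 3 * e)) * (u * (1 + (1 - u) * (1 + 20 * e))))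
        = u * e * (2 * ((1 + (1 - u) * (1 - 3 * e)) * (1 + (1 - u) * (1 + 20 * e)))) := by
          field_simp
      _ < u * e * (23 * (1 - u)) := mul_lt_mul_of_pos_left key (by positivity)
      _ = _ := by ring
  · simp only [hhor, sub_sub_cancel]
    have h1 := sq_sqrt_sub_sqrt_le (x := 1 - u * (1 - 3 * e)) (y := 1 - u * (1 + 20 * e))
      (by linarith) (by linarith)
    have h2 := sq_sqrt_sub_sqrt_le (x := u * (1 + 20 * e)) (y := u * (1 - 3 * e)) ha1 hb1.le
    rw [sub_sq_comm] at h1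
    -- The parameters differ by 23ue. Both denominators are at least u: here because 1 - u(1 - 3e) >
    -- 9/10, in `h4` because 1 + 20e > 1.
    have h3 : (1 - u * (1 - 3 * e) - (1 - u * (1 + 20 * e))) ^ 2 / (1 - u * (1 - 3 * e)) ≤
        (23 * (u * e)) ^ 2 / u := by
      refine div_le_div₀ (by positivity) (le_of_eq (by ring)) hu0 (by linarith)
    have h4 : (u * (1 + 20 * e) - u * (1 - 3 * e)) ^ 2 / (u * (1 + 20 * e)) ≤
        (23 * (u * e)) ^ 2 / u := by
      refine div_le_div₀ (by positivity) (le_of_eq (by ring)) hu0 (by nlinarith [mul_pos hu0 he0])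
    calc _ ≤ (23 * (u * e)) ^ 2 / u + (23 * (u * e)) ^ 2 / u :=
          add_le_add (h1.trans h3) (h2.trans h4)
      _ = _ := by field_simp; ring

/-! ### The classical lower bound -/

/-- The total variation distance of two distributions is bounded by their fidelity. -/
theorem sq_sub_le_of_le_affinity {x y ρ : ℝ} (hx : x ∈ Set.Icc (0 : ℝ) 1)
    (hy : y ∈ Set.Icc (0 : ℝ) 1) (hρ : 0 ≤ ρ)
    (h : ρ ≤ √(x * y) + √((1 - x) * (1 - y))) : (x - y) ^ 2 ≤ 1 - ρ ^ 2 := by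
  obtain ⟨hx0, hx1⟩ := hx
  obtain ⟨hy0, hy1⟩ := hy
  rw [Real.sqrt_mul hx0, Real.sqrt_mul (by linarith)] at h
  have ha := Real.sq_sqrt hx0
  have hb := Real.sq_sqrt hy0
  have hc := Real.sq_sqrt (sub_nonneg.2 hx1)
  have hd := Real.sq_sqrt (sub_nonneg.2 hy1)
  generalize √x = a at *
  generalize √y = b at *
  generalize √(1 - x) = c at *
  generalize √(1 - y) = d at *
  have hρ2 : ρ ^ 2 ≤ (a * b + c * d) ^ 2 := by gcongr
  have hxy : x - y = (a * d - b * c) * (a * d + b * c) := by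
    linear_combination c ^ 2 * hb + y * hc - d ^ 2 * ha - x * hd
  -- Lagrange's identity: this product equals both (ab + cd)² + (ad - bc)² and (ad + bc)² + (ab -
  -- cd)². The first form bounds (ad - bc)² by 1 - ρ², the second bounds the other factor by 1.
  have hone : (a ^ 2 + c ^ 2) * (b ^ 2 + d ^ 2) = 1 := by rw [ha, hb, hc, hd]; ring
  have hle : (a * d + b * c) ^ 2 ≤ 1 := by nlinarith [sq_nonneg (a * b - c * d)]
  rw [hxy, mul_pow]
  nlinarith [sq_nonneg (a * d - b * c)]

/-- Cauchy–Schwarz for √(P f) and √(Q g). It lets affinity pass through an average over the answer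
to one query. -/
theorem sum_sqrt_le_sqrt_sum_mul_sum {ι : Type*} (s : Finset ι) (P Q f g : ι → ℝ)
    (hP : ∀ i, 0 ≤ P i) (hQ : ∀ i, 0 ≤ Q i) (hf : ∀ i, 0 ≤ f i) (hg : ∀ i, 0 ≤ g i) :
    ∑ i ∈ s, √(P i * Q i) * √(f i * g i) ≤ √((∑ i ∈ s, P i * f i) * ∑ i ∈ s, Q i * g i) := by
  rw [Real.sqrt_mul (Finset.sum_nonneg fun i _ => mul_nonneg (hP i) (hf i))]
  refine le_trans (le_of_eq (Finset.sum_congr rfl fun i _ => ?_))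
    (Real.sum_sqrt_mul_sqrt_le s (fun i => mul_nonneg (hP i) (hf i))
      (fun i => mul_nonneg (hQ i) (hg i)))
  rw [← Real.sqrt_mul (mul_nonneg (hP i) (hQ i)), ← Real.sqrt_mul (mul_nonneg (hP i) (hf i))]
  congr 1
  ring

namespace ClassicalAlgorithm

variable {S A Out : Type} [Fintype S] [MeasurableSpace Out]

theorem successFrom_mem_Icc (alg : ClassicalAlgorithm S A Out) (M : MDP S A) (good : Set Out)
    (ω : alg.Seed) (n : ℕ) (h : List S) : alg.successFrom M good ω n h ∈ Set.Icc (0 : ℝ) 1 := by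
  induction n generalizing h with
  | zero =>
    by_cases hm : alg.output ω h ∈ good <;> simp [successFrom, hm]
  | succ n ih =>
    rw [successFrom]
    refine ⟨Finset.sum_nonneg fun s' _ => mul_nonneg (M.p_nonneg _ _ _) (ih _).1, ?_⟩
    rw [← M.p_sum (alg.query ω h).1 (alg.query ω h).2]
    exact Finset.sum_le_sum fun s' _ => mul_le_of_le_one_right (M.p_nonneg _ _ _) (ih _).2

theorem measurable_successFrom [Finite A] (alg : ClassicalAlgorithm S A Out) (M : MDP S A)
    {good : Set Out} (hgood : MeasurableSet good) (n : ℕ) (h : List S) :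
    Measurable fun ω => alg.successFrom M good ω n h := by
  induction n generalizing h with
  | zero => exact (measurable_one.indicator hgood).comp (alg.measurable_output h)
  | succ n ih =>
    simp only [successFrom]
    refine Finset.measurable_sum _ fun s' _ => Measurable.mul ?_ (ih _)
    let _ : MeasurableSpace (S × A) := ⊤
    have hq : Measurable fun ω => alg.query ω h :=
      measurable_to_countable' fun x => alg.measurableSet_query h x
    exact (measurable_from_top (f := fun x : S × A => M.p x.1 x.2 s')).comp hq

theorem integrable_successFrom [Finite A] (alg : ClassicalAlgorithm S A Out) (M : MDP S A)
    {good : Set Out} (hgood : MeasurableSet good) (n : ℕ) (h : List S) :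
    Integrable (fun ω => alg.successFrom M good ω n h) alg.seedLaw :=
  Integrable.of_bound (alg.measurable_successFrom M hgood n h).aestronglyMeasurable 1
    (Filter.Eventually.of_forall fun ω => by
      rw [Real.norm_of_nonneg (alg.successFrom_mem_Icc M good ω n h).1]
      exact (alg.successFrom_mem_Icc M good ω n h).2)

theorem one_sub_successFrom_succ (alg : ClassicalAlgorithm S A Out) (M : MDP S A)
    (good : Set Out) (ω : alg.Seed) (n : ℕ) (h : List S) :
    1 - alg.successFrom M good ω (n + 1) h =
      ∑ s', M.p (alg.query ω h).1 (alg.query ω h).2 s' *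
        (1 - alg.successFrom M good ω n (h ++ [s'])) := by
  simp_rw [successFrom, mul_sub, mul_one, Finset.sum_sub_distrib, M.p_sum]

/-- Induction on the remaining queries, with the seed fixed. With none left, both runs have the same
history and output, so the affinity is 1. For one more query, both instances receive the same query,
and Cauchy–Schwarz on the success and failure terms extracts a factor of at least ρ. Adaptivity is
harmless because ρ bounds the affinity for every query. -/
theorem pow_le_affinity (alg : ClassicalAlgorithm S A Out) (M N : MDP S A) {ρ : ℝ} (hρ : 0 ≤ ρ)
    (hMN : ∀ s a, ρ ≤ ∑ s', √(M.p s a s' * N.p s a s')) (good : Set Out) (ω : alg.Seed)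
    (n : ℕ) (h : List S) :
    ρ ^ n ≤ √(alg.successFrom M good ω n h * alg.successFrom N good ω n h) +
      √((1 - alg.successFrom M good ω n h) * (1 - alg.successFrom N good ω n h)) := by
  induction n generalizing h with
  | zero =>
    by_cases hm : alg.output ω h ∈ good <;> simp [successFrom, hm]
  | succ n ih =>
    have h0 := fun (L : MDP S A) s' => alg.successFrom_mem_Icc L good ω n (h ++ [s'])
    rw [one_sub_successFrom_succ, one_sub_successFrom_succ, successFrom, successFrom]
    refine le_trans ?_ (add_le_add
      (sum_sqrt_le_sqrt_sum_mul_sum _ _ _ _ _ (fun _ => M.p_nonneg _ _ _)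
        (fun _ => N.p_nonneg _ _ _) (fun s' => (h0 M s').1) (fun s' => (h0 N s').1))
      (sum_sqrt_le_sqrt_sum_mul_sum _ _ _ _ _ (fun _ => M.p_nonneg _ _ _)
        (fun _ => N.p_nonneg _ _ _) (fun s' => sub_nonneg.2 (h0 M s').2)
        (fun s' => sub_nonneg.2 (h0 N s').2)))
    rw [← Finset.sum_add_distrib, pow_succ']
    simp_rw [← mul_add]
    refine (mul_le_mul_of_nonneg_right (hMN (alg.query ω h).1 (alg.query ω h).2)
      (pow_nonneg hρ n)).trans ?_
    rw [Finset.sum_mul]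
    exact Finset.sum_le_sum fun s' _ => mul_le_mul_of_nonneg_left (ih _) (Real.sqrt_nonneg _)

theorem sq_successProb_sub_le [Finite A] (alg : ClassicalAlgorithm S A Out) (M N : MDP S A) {ρ : ℝ}
    (hρ0 : 0 ≤ ρ) (hMN : ∀ s a, ρ ≤ ∑ s', √(M.p s a s' * N.p s a s'))
    {good : Set Out} (hgood : MeasurableSet good)
    (hle : alg.successProb N good ≤ alg.successProb M good) :
    (alg.successProb M good - alg.successProb N good) ^ 2 ≤ 2 * alg.numQueries * (1 - ρ) := by
  -- Bernoulli's inequality with exponent 2n.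
  have hpow : 1 - (ρ ^ alg.numQueries) ^ 2 ≤ 2 * alg.numQueries * (1 - ρ) := by
    have h := one_add_mul_le_pow (a := ρ - 1) (by linarith) (2 * alg.numQueries)
    rw [add_sub_cancel, mul_comm 2, pow_mul] at h
    push_cast at h
    linarith
  have hpt : ∀ ω, (alg.successFrom M good ω alg.numQueries [] -
      alg.successFrom N good ω alg.numQueries []) ^ 2 ≤ 2 * alg.numQueries * (1 - ρ) := fun ω =>
    (sq_sub_le_of_le_affinity (alg.successFrom_mem_Icc M good ω _ _)
      (alg.successFrom_mem_Icc N good ω _ _) (pow_nonneg hρ0 _)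
      (alg.pow_le_affinity M N hρ0 hMN good ω _ _)).trans hpow
  -- The bound ρ ≤ 1 is not assumed; nonnegativity is read off from the pointwise bound at some
  -- seed, which exists since `seedLaw` is a probability measure.
  have hnn : 0 ≤ 2 * alg.numQueries * (1 - ρ) := by
    obtain ⟨ω⟩ := alg.seedLaw.nonempty_of_neZero
    exact (sq_nonneg _).trans (hpt ω)
  have hsub : alg.successProb M good - alg.successProb N good ≤
      √(2 * alg.numQueries * (1 - ρ)) := by
    rw [successProb, successProb, ← integral_sub (alg.integrable_successFrom M hgood _ _)
      (alg.integrable_successFrom N hgood _ _)]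
    calc _ ≤ ∫ _, √(2 * alg.numQueries * (1 - ρ)) ∂alg.seedLaw :=
          integral_mono ((alg.integrable_successFrom M hgood _ _).sub
            (alg.integrable_successFrom N hgood _ _)) (integrable_const _)
            fun ω => Real.le_sqrt_of_sq_le (hpt ω)
      _ = _ := by simp
  calc _ ≤ √(2 * alg.numQueries * (1 - ρ)) ^ 2 := by
        gcongr
    _ = _ := Real.sq_sqrt hnn

theorem successProb_add_le_one [Finite A] (alg : ClassicalAlgorithm S A Out) (M : MDP S A)
    {G H : Set Out} (hG : MeasurableSet G) (hH : MeasurableSet H) (hGH : Disjoint G H) :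
    alg.successProb M G + alg.successProb M H ≤ 1 := by
  have hpt : ∀ ω n h, alg.successFrom M G ω n h + alg.successFrom M H ω n h ≤ 1 := by
    intro ω n
    induction n with
    | zero =>
      intro h
      by_cases h1 : alg.output ω h ∈ G
      · simp [successFrom, h1, Set.disjoint_left.1 hGH h1]
      · by_cases h2 : alg.output ω h ∈ H <;> simp [successFrom, h1, h2]
    | succ n ih =>
      intro h
      rw [successFrom, successFrom, ← Finset.sum_add_distrib,
        ← M.p_sum (alg.query ω h).1 (alg.query ω h).2]
      refine Finset.sum_le_sum fun s' _ => ?_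
      rw [← mul_add]
      exact mul_le_of_le_one_right (M.p_nonneg _ _ _) (ih _)
  rw [successProb, successProb, ← integral_add (alg.integrable_successFrom M hG _ _)
    (alg.integrable_successFrom M hH _ _)]
  calc _ ≤ ∫ _, (1 : ℝ) ∂alg.seedLaw :=
        integral_mono ((alg.integrable_successFrom M hG _ _).add
          (alg.integrable_successFrom M hH _ _)) (integrable_const _) fun ω => hpt ω _ _
    _ = _ := by simp

end ClassicalAlgorithm

theorem disjoint_setOf_norm_sub_le {E : Type*} [NormedAddCommGroup E] {v w : E} {ε : ℝ}
    (h : 2 * ε < ‖v - w‖) : Disjoint {o | ‖v - o‖ ≤ ε} {o | ‖w - o‖ ≤ ε} := by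
  refine Set.disjoint_left.2 fun o (h1 : ‖v - o‖ ≤ ε) (h2 : ‖w - o‖ ≤ ε) => ?_
  have := norm_sub_le (v - o) (w - o)
  rw [sub_sub_sub_cancel_right] at this
  linarith

theorem ClassicalAlgorithm.Approximates.sq_le {S A Out : Type} [Fintype S] [Finite A]
    [NormedAddCommGroup Out] [MeasurableSpace Out] [OpensMeasurableSpace Out]
    {alg : ClassicalAlgorithm S A Out} {𝓜 : Set (MDP S A)} {target : MDP S A → Out} {ε δ : ℝ}
    (h : alg.Approximates 𝓜 target ε δ) (hδ : δ ≤ 1 / 2) {M N : MDP S A} (hM : M ∈ 𝓜) (hN : N ∈ 𝓜)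
    (hsep : 2 * ε < ‖target M - target N‖) {ρ : ℝ} (hρ0 : 0 ≤ ρ)
    (hMN : ∀ s a, ρ ≤ ∑ s', √(M.p s a s' * N.p s a s')) :
    (1 - 2 * δ) ^ 2 ≤ 2 * alg.numQueries * (1 - ρ) := by
  have hmeas : ∀ v : Out, MeasurableSet {o | ‖v - o‖ ≤ ε} := fun v =>
    (isClosed_le (by fun_prop) continuous_const).measurableSet
  have h1 := h M hM
  have h2 := h N hN
  have h3 := alg.successProb_add_le_one N (hmeas (target M)) (hmeas (target N))
    (disjoint_setOf_norm_sub_le hsep)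
  refine le_trans ?_ (alg.sq_successProb_sub_le M N hρ0 hMN (hmeas (target M)) (by linarith))
  -- By disjointness, the set of outputs correct for M has probability at most δ under N, against at
  -- least 1 - δ under M.
  exact pow_le_pow_left₀ (by linarith) (by linarith) 2

theorem twoStateMDP_affinity (γ : Set.Ico (0 : ℝ) 1) (a b : Set.Ioo (0 : ℝ) 1) (s : Fin 2)
    (x : Fin 1) :
    1 - ((√(a : ℝ) - √(b : ℝ)) ^ 2 + (√(1 - a : ℝ) - √(1 - b : ℝ)) ^ 2) / 2 ≤
      ∑ s', √((twoStateMDP γ a).p s x s' * (twoStateMDP γ b).p s x s') := by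
  have ha := a.2.1.le
  have hb := b.2.1.le
  have ha' := sub_nonneg.2 a.2.2.le
  have hb' := sub_nonneg.2 b.2.2.le
  fin_cases s
  · simp only [twoStateMDP, Fin.sum_univ_two]
    simp only [Fin.zero_eta, if_true, one_ne_zero, if_false]
    rw [Real.sqrt_mul ha, Real.sqrt_mul ha']
    refine le_of_eq ?_
    -- At the source equality holds: √x√y = (x + y - (√x - √y)²)/2, summed over both outcomes. At
    -- the sink the two laws coincide.
    linear_combination -(1 / 2) * (Real.sq_sqrt ha + Real.sq_sqrt hb + Real.sq_sqrt ha' +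
      Real.sq_sqrt hb')
  · simp only [twoStateMDP, Fin.sum_univ_two]
    simp
    positivity

/-! ### The quantum lower bound -/

open Matrix in
-- Unitaries, differences of the chosen oracles and measurement projections all have a diagonal Gram
-- matrix, so every norm estimate needed reduces to reading off diagonal entries.
theorem norm_sq_mulVec_of_conjTranspose_mul_self {m n : Type*} [Fintype m] [Fintype n]
    [DecidableEq n] {A : Matrix m n ℂ} {d : n → ℝ}
    (h : Aᴴ * A = diagonal fun i => (d i : ℂ)) (v : n → ℂ) :
    ‖WithLp.toLp 2 (A *ᵥ v)‖ ^ 2 = ∑ i, d i * ‖v i‖ ^ 2 := by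
  have hself : ∀ {k : Type _} [Fintype k] (w : k → ℂ),
      ((‖WithLp.toLp 2 w‖ ^ 2 : ℝ) : ℂ) = star w ⬝ᵥ w := by
    intro k _ w
    rw [EuclideanSpace.norm_sq_eq]
    push_cast
    exact Finset.sum_congr rfl fun i _ => (Complex.conj_mul' (w i)).symm
  apply Complex.ofReal_injective
  rw [hself, star_mulVec, ← dotProduct_mulVec, mulVec_mulVec, h]
  push_cast
  refine Finset.sum_congr rfl fun i _ => ?_
  rw [mulVec_diagonal, ← Complex.conj_mul', Pi.star_apply, RCLike.star_def]
  ring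

open Matrix in
theorem norm_mulVec_le_of_conjTranspose_mul_self {m n : Type*} [Fintype m] [Fintype n]
    [DecidableEq n] {A : Matrix m n ℂ} {d : n → ℝ}
    (h : Aᴴ * A = diagonal fun i => (d i : ℂ)) {η : ℝ} (hη : 0 ≤ η) (hd : ∀ i, d i ≤ η ^ 2)
    (v : n → ℂ) : ‖WithLp.toLp 2 (A *ᵥ v)‖ ≤ η * ‖WithLp.toLp 2 v‖ := by
  refine le_of_sq_le_sq ?_ (by positivity)
  rw [norm_sq_mulVec_of_conjTranspose_mul_self h, mul_pow, EuclideanSpace.norm_sq_eq,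
    Finset.mul_sum]
  exact Finset.sum_le_sum fun i _ => mul_le_mul_of_nonneg_right (hd i) (sq_nonneg _)

open Matrix in
theorem norm_mulVec_of_conjTranspose_mul_self_eq_one {m n : Type*} [Fintype m] [Fintype n]
    [DecidableEq n] {A : Matrix m n ℂ} (h : Aᴴ * A = 1) (v : n → ℂ) :
    ‖WithLp.toLp 2 (A *ᵥ v)‖ = ‖WithLp.toLp 2 v‖ := by
  rw [← sq_eq_sq₀ (norm_nonneg _) (norm_nonneg _),
    norm_sq_mulVec_of_conjTranspose_mul_self (d := 1) (by simpa using h), EuclideanSpace.norm_sq_eq]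
  simp

open Matrix in
theorem conjTranspose_mul_self_blockDiagonal {m o : Type*} [Fintype m] [Fintype o] [DecidableEq m]
    [DecidableEq o] {A : o → Matrix m m ℂ} {d : o → m → ℂ}
    (h : ∀ w, (A w)ᴴ * A w = diagonal (d w)) :
    (blockDiagonal A)ᴴ * blockDiagonal A = diagonal fun x => d x.2 x.1 := by
  rw [blockDiagonal_conjTranspose, ← blockDiagonal_mul, ← blockDiagonal_diagonal]
  exact congrArg _ (funext h)

/-- Both `Aᴴ A` and `A Aᴴ` are the real diagonal matrix `d`. -/
def IsDiagonalGram {Q : Type*} [Fintype Q] [DecidableEq Q] (A : Matrix Q Q ℂ) (d : Q → ℝ) : Prop :=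
  A.conjTranspose * A = Matrix.diagonal (fun i => (d i : ℂ)) ∧
    A * A.conjTranspose = Matrix.diagonal fun i => (d i : ℂ)

namespace QuantumAlgorithm

variable {Q Out : Type} [Fintype Q] [DecidableEq Q]

open Matrix in
theorem conjTranspose_mul_self_modeOp (O : unitaryGroup Q ℂ) (m : QueryMode) :
    (modeOp O m)ᴴ * modeOp O m = 1 := by
  cases m
  · simp [modeOp]
  · exact mem_unitaryGroup_iff'.1 O.2
  · rw [modeOp, conjTranspose_conjTranspose]
    exact mem_unitaryGroup_iff.1 O.2

open Matrix in
theorem conjTranspose_mul_self_queryOp (alg : QuantumAlgorithm Q Out) (O : unitaryGroup Q ℂ)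
    (t : ℕ) : (alg.queryOp O t)ᴴ * alg.queryOp O t = 1 := by
  rw [queryOp, conjTranspose_mul_self_blockDiagonal (d := fun _ _ => 1)
    fun w => by rw [conjTranspose_mul_self_modeOp, diagonal_one]]
  exact diagonal_one

theorem norm_state (alg : QuantumAlgorithm Q Out) (O : Matrix.unitaryGroup Q ℂ) (t : ℕ) :
    ‖WithLp.toLp 2 (alg.state O t)‖ = 1 := by
  induction t with
  | zero =>
    rw [state, norm_mulVec_of_conjTranspose_mul_self_eq_one
      (Matrix.mem_unitaryGroup_iff'.1 (alg.gate 0).2)]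
    exact (PiLp.norm_single 2 (fun _ => ℂ) alg.start 1).trans norm_one
  | succ t ih =>
    rw [state, norm_mulVec_of_conjTranspose_mul_self_eq_one
      (Matrix.mem_unitaryGroup_iff'.1 (alg.gate (t + 1)).2),
      norm_mulVec_of_conjTranspose_mul_self_eq_one (alg.conjTranspose_mul_self_queryOp O t), ih]

theorem norm_queryOp_sub_mulVec_le (alg : QuantumAlgorithm Q Out) (O O' : Matrix.unitaryGroup Q ℂ)
    {d : Q → ℝ} (hd : IsDiagonalGram (O - O' : Matrix Q Q ℂ) d) {η : ℝ} (hη : 0 ≤ η)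
    (hdη : ∀ i, d i ≤ η ^ 2) (t : ℕ) (v : Q × alg.W → ℂ) :
    ‖WithLp.toLp 2 (Matrix.mulVec (alg.queryOp O t - alg.queryOp O' t) v)‖ ≤
      η * ‖WithLp.toLp 2 v‖ := by
  rw [queryOp, queryOp, ← Matrix.blockDiagonal_sub]
  -- A skipped query contributes 0, a forward query the Gram matrix of O - O', and an inverse query
  -- that of its adjoint; hence both halves of `IsDiagonalGram` are used.
  have hgram := conjTranspose_mul_self_blockDiagonal
    (A := (fun w => modeOp O (alg.mode t w)) - fun w => modeOp O' (alg.mode t w))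
    (d := fun w i => ((match alg.mode t w with | .skip => 0 | _ => d i : ℝ) : ℂ)) (by
      intro w
      rw [Pi.sub_apply]
      cases alg.mode t w
      · simp [modeOp]
      · simpa [modeOp] using hd.1
      · simpa [modeOp] using hd.2)
  refine norm_mulVec_le_of_conjTranspose_mul_self hgram hη (fun i => ?_) v
  cases alg.mode t i.2
  · exact sq_nonneg η
  · exact hdη _
  · exact hdη _

/-- Hybrid argument: each query changes the distance of the states for two oracles by at most the
distance of the oracles. -/
theorem norm_state_sub_le (alg : QuantumAlgorithm Q Out) (O O' : Matrix.unitaryGroup Q ℂ)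
    {d : Q → ℝ} (hd : IsDiagonalGram (O - O' : Matrix Q Q ℂ) d) {η : ℝ} (hη : 0 ≤ η)
    (hdη : ∀ i, d i ≤ η ^ 2) (t : ℕ) :
    ‖WithLp.toLp 2 (alg.state O t - alg.state O' t)‖ ≤ t * η := by
  induction t with
  | zero => simp [state]
  | succ t ih =>
    -- The accumulated error is transported by a unitary and keeps its norm; the new error comes
    -- from the difference of the oracles acting on a unit vector.
    have hsplit : Matrix.mulVec (alg.queryOp O t) (alg.state O t) -
        Matrix.mulVec (alg.queryOp O' t) (alg.state O' t) =
        Matrix.mulVec (alg.queryOp O t) (alg.state O t - alg.state O' t) +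
        Matrix.mulVec (alg.queryOp O t - alg.queryOp O' t) (alg.state O' t) := by
      rw [Matrix.mulVec_sub, Matrix.sub_mulVec, sub_add_sub_cancel]
    rw [state, state, ← Matrix.mulVec_sub, norm_mulVec_of_conjTranspose_mul_self_eq_one
      (Matrix.mem_unitaryGroup_iff'.1 (alg.gate (t + 1)).2), hsplit, WithLp.toLp_add]
    refine (norm_add_le _ _).trans ?_
    rw [norm_mulVec_of_conjTranspose_mul_self_eq_one (alg.conjTranspose_mul_self_queryOp O t)]
    have h := alg.norm_queryOp_sub_mulVec_le O O' hd hη hdη t (alg.state O' t)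
    rw [norm_state, mul_one] at h
    push_cast
    linarith

theorem successProb_add_le_one (alg : QuantumAlgorithm Q Out) (O : Matrix.unitaryGroup Q ℂ)
    {G H : Set Out} (hGH : Disjoint G H) : alg.successProb O G + alg.successProb O H ≤ 1 := by
  have hnorm := congrArg (· ^ 2) (alg.norm_state O alg.numQueries)
  simp only [EuclideanSpace.norm_sq_eq, one_pow] at hnorm
  rw [← hnorm, successProb, successProb, ← Finset.sum_add_distrib]
  refine Finset.sum_le_sum fun x _ => ?_
  rw [← mul_add]
  refine mul_le_of_le_one_right (sq_nonneg _) ?_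
  by_cases h1 : alg.output x ∈ G
  · simp [h1, Set.disjoint_left.1 hGH h1]
  · by_cases h2 : alg.output x ∈ H <;> simp [h1, h2]

theorem successProb_sub_le (alg : QuantumAlgorithm Q Out) (O O' : Matrix.unitaryGroup Q ℂ)
    (good : Set Out) : alg.successProb O good - alg.successProb O' good ≤
      2 * ‖WithLp.toLp 2 (alg.state O alg.numQueries - alg.state O' alg.numQueries)‖ := by
  -- P projects onto the good outcomes, so the probabilities are squared norms ‖Pv‖²; a difference
  -- of squares of numbers in [0,1] is at most twice their distance.
  set P : Matrix (Q × alg.W) (Q × alg.W) ℂ :=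
    Matrix.diagonal fun x => good.indicator 1 (alg.output x) with hP
  have hgram : P.conjTranspose * P =
      Matrix.diagonal fun x => ((good.indicator 1 (alg.output x) : ℝ) : ℂ) := by
    rw [hP, Matrix.diagonal_conjTranspose, Matrix.diagonal_mul_diagonal]
    congr 1
    funext x
    by_cases h : alg.output x ∈ good <;> simp [h]
  have hprob : ∀ U, alg.successProb U good =
      ‖WithLp.toLp 2 (P.mulVec (alg.state U alg.numQueries))‖ ^ 2 := fun U => by
    rw [norm_sq_mulVec_of_conjTranspose_mul_self hgram, successProb]
    simp_rw [mul_comm]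
  have hle : ∀ v, ‖WithLp.toLp 2 (P.mulVec v)‖ ≤ ‖WithLp.toLp 2 v‖ := fun v => by
    refine (norm_mulVec_le_of_conjTranspose_mul_self hgram zero_le_one (fun x => ?_) v).trans
      (one_mul _).le
    by_cases h : alg.output x ∈ good <;> simp [h]
  have h1 := hle (alg.state O alg.numQueries)
  have h2 := hle (alg.state O' alg.numQueries)
  have h3 := hle (alg.state O alg.numQueries - alg.state O' alg.numQueries)
  rw [norm_state] at h1 h2
  have h4 := norm_sub_norm_le (WithLp.toLp 2 (P.mulVec (alg.state O alg.numQueries)))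
    (WithLp.toLp 2 (P.mulVec (alg.state O' alg.numQueries)))
  rw [← WithLp.toLp_sub, ← Matrix.mulVec_sub] at h4
  rw [hprob, hprob]
  have h0 := norm_nonneg (WithLp.toLp 2 (alg.state O alg.numQueries - alg.state O' alg.numQueries))
  nlinarith [norm_nonneg (WithLp.toLp 2 (P.mulVec (alg.state O alg.numQueries))),
    norm_nonneg (WithLp.toLp 2 (P.mulVec (alg.state O' alg.numQueries)))]

end QuantumAlgorithm

theorem QuantumAlgorithm.Approximates.le_numQueries_mul {S A J Out : Type} [Fintype S]
    [DecidableEq S] [Inhabited S] [Fintype A] [DecidableEq A] [Fintype J] [DecidableEq J]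
    [Inhabited J] [NormedAddCommGroup Out] {alg : QuantumAlgorithm (QReg S A J) Out}
    {𝓜 : Set (MDP S A)} {target : MDP S A → Out} {ε δ : ℝ}
    (h : alg.Approximates 𝓜 target ε δ) {M N : MDP S A} (hM : M ∈ 𝓜) (hN : N ∈ 𝓜)
    (hsep : 2 * ε < ‖target M - target N‖) {O O' : Matrix.unitaryGroup (QReg S A J) ℂ}
    (hO : IsQuantumGenerativeOracle M O) (hO' : IsQuantumGenerativeOracle N O')
    {d : QReg S A J → ℝ} (hd : IsDiagonalGram (O - O' : Matrix (QReg S A J) (QReg S A J) ℂ) d)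
    {η : ℝ} (hη : 0 ≤ η) (hdη : ∀ i, d i ≤ η ^ 2) :
    1 - 2 * δ ≤ 2 * (alg.numQueries * η) := by
  have h1 := h M hM O hO
  have h2 := h N hN O' hO'
  have h3 := alg.successProb_add_le_one O' (disjoint_setOf_norm_sub_le hsep)
  have h4 := alg.successProb_sub_le O O' {o | ‖target M - o‖ ≤ ε}
  have h5 := alg.norm_state_sub_le O O' hd hη hdη alg.numQueries
  linarith

/-- Reordering of the basis of the query register that isolates the next state. -/
def qregEquiv (S A J : Type) : QReg S A J ≃ S × (S × A × J) where
  toFun x := (x.2.2.1, x.1, x.2.1, x.2.2.2)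
  invFun y := (y.2.1, y.2.2.1, y.1, y.2.2.2)
  left_inv _ := rfl
  right_inv _ := rfl

section ControlledOp

variable {S A J : Type} [DecidableEq S] [DecidableEq A] [DecidableEq J]

/-- The operator that applies `B s` to the register of the next state, controlled by the state `s`. -/
def controlledOp (A J : Type) [DecidableEq A] [DecidableEq J] (B : S → Matrix S S ℂ) :
    Matrix (QReg S A J) (QReg S A J) ℂ :=
  (Matrix.blockDiagonal fun o : S × A × J => B o.1).submatrix (qregEquiv S A J) (qregEquiv S A J)

theorem controlledOp_mul [Fintype S] [Fintype A] [Fintype J] (B C : S → Matrix S S ℂ) :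
    controlledOp A J B * controlledOp A J C = controlledOp A J fun s => B s * C s := by
  rw [controlledOp, controlledOp, Matrix.submatrix_mul_equiv, ← Matrix.blockDiagonal_mul]
  rfl

theorem conjTranspose_controlledOp (B : S → Matrix S S ℂ) :
    (controlledOp A J B).conjTranspose = controlledOp A J fun s => (B s).conjTranspose := by
  rw [controlledOp, Matrix.conjTranspose_submatrix, Matrix.blockDiagonal_conjTranspose]
  rfl

theorem controlledOp_sub (B C : S → Matrix S S ℂ) :
    controlledOp A J B - controlledOp A J C = controlledOp A J fun s => B s - C s := by
  change ((Matrix.blockDiagonal fun o : S × A × J => B o.1) -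
    Matrix.blockDiagonal fun o : S × A × J => C o.1).submatrix (qregEquiv S A J) (qregEquiv S A J) = _
  rw [← Matrix.blockDiagonal_sub]
  rfl

theorem controlledOp_diagonal (d : S → S → ℂ) :
    controlledOp A J (fun s => Matrix.diagonal (d s)) =
      Matrix.diagonal fun x => d x.1 x.2.2.1 := by
  rw [controlledOp, Matrix.blockDiagonal_diagonal, Matrix.submatrix_diagonal_equiv]
  rfl

theorem controlledOp_isDiagonalGram [Fintype S] [Fintype A] [Fintype J]
    {B : S → Matrix S S ℂ} {d : S → S → ℝ}
    (h : ∀ s, IsDiagonalGram (B s) (d s)) :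
    IsDiagonalGram (controlledOp A J B) fun x => d x.1 x.2.2.1 := by
  constructor
  · rw [conjTranspose_controlledOp, controlledOp_mul, funext fun s => (h s).1,
      controlledOp_diagonal]
  · rw [conjTranspose_controlledOp, controlledOp_mul, funext fun s => (h s).2,
      controlledOp_diagonal]

theorem controlledOp_apply (B : S → Matrix S S ℂ) (x y : QReg S A J) :
    controlledOp A J B x y =
      if x.1 = y.1 ∧ x.2.1 = y.2.1 ∧ x.2.2.2 = y.2.2.2 then B x.1 x.2.2.1 y.2.2.1 else 0 := by
  simp [controlledOp, qregEquiv, Matrix.blockDiagonal_apply]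

/-- The unitary that applies `B s` to the register of the next state, controlled by the state `s`. -/
def controlledUnitary [Fintype S] (A J : Type) [Fintype A] [DecidableEq A] [Fintype J] [DecidableEq J]
    (B : S → Matrix.unitaryGroup S ℂ) : Matrix.unitaryGroup (QReg S A J) ℂ :=
  ⟨controlledOp A J fun s => B s, by
    rw [Matrix.mem_unitaryGroup_iff, Matrix.star_eq_conjTranspose, conjTranspose_controlledOp,
      controlledOp_mul]
    have h : (fun s => (B s : Matrix S S ℂ) * (B s : Matrix S S ℂ).conjTranspose) =
        fun _ => Matrix.diagonal fun _ => 1 := funext fun s => by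
      rw [Matrix.diagonal_one]
      exact Matrix.mem_unitaryGroup_iff.1 (B s).2
    rw [h, controlledOp_diagonal, Matrix.diagonal_one]⟩

/-- An oracle is constrained only on inputs with default next state and ancilla, so only the default
column of each block matters, and the ancilla can stay in its default state for every J. -/
theorem controlledUnitary_isQuantumGenerativeOracle [Fintype S] [Fintype A] [Fintype J]
    [Inhabited S] [Inhabited J] (M : MDP S A)
    (B : S → Matrix.unitaryGroup S ℂ)
    (hB : ∀ s a s', (B s : Matrix S S ℂ) s' default = (√(M.p s a s') : ℂ)) :
    IsQuantumGenerativeOracle M (controlledUnitary A J B) := by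
  refine ⟨fun _ _ _ => EuclideanSpace.single default 1, fun _ _ _ => by simp, fun s a => ?_⟩
  funext x
  rw [Matrix.mulVec_single_one, Matrix.col_apply]
  refine (controlledOp_apply (fun s => (B s : Matrix S S ℂ)) x (s, a, default, default)).trans ?_
  by_cases h : x.1 = s ∧ x.2.1 = a
  · obtain ⟨rfl, rfl⟩ := h
    by_cases hj : x.2.2.2 = default <;> simp [hj, ← hB]
  · rw [if_neg h, if_neg]
    exact fun h' => h ⟨h'.1, h'.2.1⟩

end ControlledOp

/-- The rotation by the angle `arccos (√p)` if the state is the source, and the flip if it is the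
sink. -/
noncomputable def twoStateRotation (p : ℝ) (s : Fin 2) : Matrix (Fin 2) (Fin 2) ℂ :=
  if s = 0 then !![(√p : ℂ), -(√(1 - p) : ℂ); (√(1 - p) : ℂ), (√p : ℂ)] else !![0, 1; 1, 0]

theorem isDiagonalGram_rotation (x y : ℝ) :
    IsDiagonalGram !![(x : ℂ), -(y : ℂ); (y : ℂ), (x : ℂ)] fun _ => x ^ 2 + y ^ 2 := by
  constructor <;>
  · ext i j
    fin_cases i <;> fin_cases j <;> simp [Matrix.mul_apply, Fin.sum_univ_two] <;> ring

/-- `twoStateRotation` as a unitary. -/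
noncomputable def twoStateUnitary (p : Set.Ioo (0 : ℝ) 1) (s : Fin 2) : Matrix.unitaryGroup (Fin 2) ℂ :=
  ⟨twoStateRotation p s, by
    rw [Matrix.mem_unitaryGroup_iff, Matrix.star_eq_conjTranspose, twoStateRotation]
    split_ifs
    · rw [(isDiagonalGram_rotation _ _).2, Real.sq_sqrt p.2.1.le,
        Real.sq_sqrt (sub_nonneg.2 p.2.2.le)]
      simp
    · ext i j
      fin_cases i <;> fin_cases j <;> simp [Matrix.mul_apply, Fin.sum_univ_two]⟩

theorem twoStateUnitary_isQuantumGenerativeOracle (J : Type) [Fintype J] [DecidableEq J]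
    [Inhabited J] (γ : Set.Ico (0 : ℝ) 1) (p : Set.Ioo (0 : ℝ) 1) :
    IsQuantumGenerativeOracle (twoStateMDP γ p)
      (controlledUnitary (Fin 1) J (twoStateUnitary p)) := by
  refine controlledUnitary_isQuantumGenerativeOracle _ _ fun s a s' => ?_
  fin_cases s <;> fin_cases s' <;> simp [twoStateUnitary, twoStateRotation, twoStateMDP]

/-- The difference of two rotation blocks again has the form of a scaled rotation, so its Gram
matrix is the squared Hellinger distance times the identity. At the sink the oracles agree. -/
theorem twoStateUnitary_sub_isDiagonalGram (J : Type) [Fintype J] [DecidableEq J]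
    (a b : Set.Ioo (0 : ℝ) 1) :
    IsDiagonalGram ((controlledUnitary (Fin 1) J (twoStateUnitary a) :
        Matrix (QReg (Fin 2) (Fin 1) J) (QReg (Fin 2) (Fin 1) J) ℂ) -
        (controlledUnitary (Fin 1) J (twoStateUnitary b) :
          Matrix (QReg (Fin 2) (Fin 1) J) (QReg (Fin 2) (Fin 1) J) ℂ))
      fun x => if x.1 = 0 then
        (√(a : ℝ) - √(b : ℝ)) ^ 2 + (√(1 - a : ℝ) - √(1 - b : ℝ)) ^ 2 else 0 := by
  change IsDiagonalGram (controlledOp (Fin 1) J (fun s => twoStateRotation a s) -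
    controlledOp (Fin 1) J fun s => twoStateRotation b s) _
  rw [controlledOp_sub]
  refine controlledOp_isDiagonalGram (d := fun s _ => if s = 0 then
        (√(a : ℝ) - √(b : ℝ)) ^ 2 + (√(1 - a : ℝ) - √(1 - b : ℝ)) ^ 2 else 0) fun s => ?_
  by_cases h : s = 0
  · convert isDiagonalGram_rotation (√(a : ℝ) - √(b : ℝ)) (√(1 - a : ℝ) - √(1 - b : ℝ)) using 1
    · ext i j
      fin_cases i <;> fin_cases j <;> simp [h, twoStateRotation]
      ring
    · simp [h]
  · simp [h, twoStateRotation, IsDiagonalGram]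

/-! ### The lower bounds -/

theorem classical_lower_bound {Out : Type} [NormedAddCommGroup Out] [MeasurableSpace Out]
    [OpensMeasurableSpace Out] {alg : ClassicalAlgorithm (Fin 2) (Fin 1) Out}
    {γ : Set.Ico (0 : ℝ) 1} {ε δ : ℝ} (hδ : δ ≤ 1 / 2) {target : MDP (Fin 2) (Fin 1) → Out}
    (h : alg.Approximates (promisedFamily γ ε) target ε δ) {a b : Set.Ioo (0 : ℝ) 1}
    (ha : twoStateMDP γ a ∈ promisedFamily γ ε) (hb : twoStateMDP γ b ∈ promisedFamily γ ε)
    (hsep : 2 * ε < ‖target (twoStateMDP γ a) - target (twoStateMDP γ b)‖) :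
    (1 - 2 * δ) ^ 2 ≤ alg.numQueries *
      ((√(a : ℝ) - √(b : ℝ)) ^ 2 + (√(1 - a : ℝ) - √(1 - b : ℝ)) ^ 2) := by
  have hρ : 0 ≤ 1 - ((√(a : ℝ) - √(b : ℝ)) ^ 2 + (√(1 - a : ℝ) - √(1 - b : ℝ)) ^ 2) / 2 := by
    have h1 := Real.sq_sqrt a.2.1.le
    have h2 := Real.sq_sqrt b.2.1.le
    have h3 := Real.sq_sqrt (sub_nonneg.2 a.2.2.le)
    have h4 := Real.sq_sqrt (sub_nonneg.2 b.2.2.le)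
    nlinarith [mul_nonneg (Real.sqrt_nonneg (a : ℝ)) (Real.sqrt_nonneg (b : ℝ)),
      mul_nonneg (Real.sqrt_nonneg (1 - a : ℝ)) (Real.sqrt_nonneg (1 - b : ℝ))]
  exact (h.sq_le hδ ha hb hsep hρ (twoStateMDP_affinity γ a b)).trans (le_of_eq (by ring))

theorem quantum_lower_bound {J Out : Type} [Fintype J] [DecidableEq J] [Inhabited J]
    [NormedAddCommGroup Out] {alg : QuantumAlgorithm (QReg (Fin 2) (Fin 1) J) Out}
    {γ : Set.Ico (0 : ℝ) 1} {ε δ : ℝ} {target : MDP (Fin 2) (Fin 1) → Out}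
    (h : alg.Approximates (promisedFamily γ ε) target ε δ) {a b : Set.Ioo (0 : ℝ) 1}
    (ha : twoStateMDP γ a ∈ promisedFamily γ ε) (hb : twoStateMDP γ b ∈ promisedFamily γ ε)
    (hsep : 2 * ε < ‖target (twoStateMDP γ a) - target (twoStateMDP γ b)‖) :
    1 - 2 * δ ≤ 2 * (alg.numQueries *
      √((√(a : ℝ) - √(b : ℝ)) ^ 2 + (√(1 - a : ℝ) - √(1 - b : ℝ)) ^ 2)) := by
  refine h.le_numQueries_mul ha hb hsep (twoStateUnitary_isQuantumGenerativeOracle J γ a)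
    (twoStateUnitary_isQuantumGenerativeOracle J γ b) (twoStateUnitary_sub_isDiagonalGram J a b)
    (Real.sqrt_nonneg _) fun i => ?_
  rw [Real.sq_sqrt (by positivity)]
  split_ifs
  · exact le_rfl
  · positivity

theorem mainTheorem6 (δ : ℝ) (hδ : δ ∈ Set.Ioo (0 : ℝ) (1 / 2)) :
    ∃ c : ℝ, 0 < c ∧ ∀ γ : Set.Ico (0 : ℝ) 1, 0.9 ≤ (γ : ℝ) →
      ∀ ε ∈ Set.Ioo (0 : ℝ) (horizon γ / 4),
        (∀ alg : ClassicalAlgorithm (Fin 2) (Fin 1) (Fin 2 → ℝ),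
          alg.Approximates (promisedFamily γ ε) MDP.vStar ε δ →
            c * (horizon γ ^ 3 / ε ^ 2) ≤ alg.numQueries) ∧
        (∀ alg : ClassicalAlgorithm (Fin 2) (Fin 1) (Fin 2 × Fin 1 → ℝ),
          alg.Approximates (promisedFamily γ ε) MDP.qStar ε δ →
            c * (horizon γ ^ 3 / ε ^ 2) ≤ alg.numQueries) ∧
        (∀ (J : ℕ) [NeZero J] (alg : QuantumAlgorithm (QReg (Fin 2) (Fin 1) (Fin J)) (Fin 2 → ℝ)),
          alg.Approximates (promisedFamily γ ε) MDP.vStar ε δ →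
            c * (horizon γ ^ (1.5 : ℝ) / ε) ≤ alg.numQueries) ∧
        (∀ (J : ℕ) [NeZero J]
            (alg : QuantumAlgorithm (QReg (Fin 2) (Fin 1) (Fin J)) (Fin 2 × Fin 1 → ℝ)),
          alg.Approximates (promisedFamily γ ε) MDP.qStar ε δ →
            c * (horizon γ ^ (1.5 : ℝ) / ε) ≤ alg.numQueries) := by
  obtain ⟨hδ0, hδ1⟩ := hδ
  have hδ2 : 0 < 1 - 2 * δ := by linarith
  -- One constant serves all four claims: the classical argument yields (1 - 2δ)²/1058 and the
  -- quantum one (1 - 2δ)/66, which is larger because 0 < 1 - 2δ < 1.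
  refine ⟨(1 - 2 * δ) ^ 2 / 1058, by positivity, fun γ hγ ε hε => ?_⟩
  obtain ⟨a, b, ha, hb, hsep, hdist⟩ := exists_separated_pair γ hγ ε hε
  have hε0 := hε.1
  have hΓ : 0 < horizon γ := inv_pos.2 (sub_pos.2 γ.2.2)
  have hv : 2 * ε < ‖(twoStateMDP γ a).vStar - (twoStateMDP γ b).vStar‖ := by
    refine lt_of_lt_of_le ?_ (norm_le_pi_norm _ 0)
    rw [Pi.sub_apply, twoStateMDP_vStar, twoStateMDP_vStar, norm_sub_rev]
    exact hsep.trans_le (Real.le_norm_self _)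
  have hq : 2 * ε < ‖(twoStateMDP γ a).qStar - (twoStateMDP γ b).qStar‖ := by
    refine lt_of_lt_of_le ?_ (norm_le_pi_norm _ (0, 0))
    rw [Pi.sub_apply, twoStateMDP_qStar, twoStateMDP_qStar, norm_sub_rev]
    exact hsep.trans_le (Real.le_norm_self _)
  have hclassical : ∀ n : ℕ, (1 - 2 * δ) ^ 2 ≤ n *
      ((√(a : ℝ) - √(b : ℝ)) ^ 2 + (√(1 - a : ℝ) - √(1 - b : ℝ)) ^ 2) →
      (1 - 2 * δ) ^ 2 / 1058 * (horizon γ ^ 3 / ε ^ 2) ≤ n := by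
    intro n hn
    have h := hn.trans (mul_le_mul_of_nonneg_left hdist n.cast_nonneg)
    rw [div_mul_div_comm, div_le_iff₀ (by positivity)]
    calc _ ≤ n * (1058 * (ε ^ 2 / horizon γ ^ 3)) * horizon γ ^ 3 := by gcongr
      _ = _ := by field_simp
  have hquantum : ∀ n : ℕ, 1 - 2 * δ ≤ 2 * (n *
      √((√(a : ℝ) - √(b : ℝ)) ^ 2 + (√(1 - a : ℝ) - √(1 - b : ℝ)) ^ 2)) →
      (1 - 2 * δ) ^ 2 / 1058 * (horizon γ ^ (1.5 : ℝ) / ε) ≤ n := by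
    intro n hn
    have hpow : (horizon γ ^ (1.5 : ℝ)) ^ 2 = horizon γ ^ 3 := by
      rw [← Real.rpow_natCast, ← Real.rpow_mul hΓ.le, ← Real.rpow_natCast]
      norm_num
    have hP : 0 < horizon γ ^ (1.5 : ℝ) := Real.rpow_pos_of_pos hΓ _
    -- 33² = 1089 ≥ 1058; with the factor 2 in `hn` this gives 66.
    have hroot : √((√(a : ℝ) - √(b : ℝ)) ^ 2 + (√(1 - a : ℝ) - √(1 - b : ℝ)) ^ 2) ≤
        33 * (ε / horizon γ ^ (1.5 : ℝ)) := by
      refine Real.sqrt_le_iff.2 ⟨by positivity, hdist.trans ?_⟩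
      rw [mul_pow, div_pow, hpow]
      gcongr
      norm_num
    have h := hn.trans (mul_le_mul_of_nonneg_left
      (mul_le_mul_of_nonneg_left hroot n.cast_nonneg) zero_le_two)
    rw [div_mul_div_comm, div_le_iff₀ (by positivity)]
    calc (1 - 2 * δ) ^ 2 * horizon γ ^ (1.5 : ℝ) ≤ (1 - 2 * δ) * horizon γ ^ (1.5 : ℝ) := by
          gcongr
          nlinarith
      _ ≤ 2 * (n * (33 * (ε / horizon γ ^ (1.5 : ℝ)))) * horizon γ ^ (1.5 : ℝ) := by gcongr
      _ = n * (66 * ε) := by field_simp; ring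
      _ ≤ _ := by gcongr; norm_num
  exact ⟨fun alg h => hclassical _ (classical_lower_bound hδ1.le h ha hb hv),
    fun alg h => hclassical _ (classical_lower_bound hδ1.le h ha hb hq),
    fun J _ alg h => hquantum _ (quantum_lower_bound h ha hb hv),
    fun J _ alg h => hquantum _ (quantum_lower_bound h ha hb hq)⟩
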